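/- Let $a>0$ and let $\alpha$ be a finite Borel measure on $\mathbb{R}$ with $\alpha(\mathbb{R})=a$, $\int_{\mathbb{R}}\log(1+|x|)\,\alpha(dx)<+\infty$ and $\alpha\{0\}<a$. Let $\tilde\gamma$ be a gamma process with parameter $\alpha$, i.e. a random finite measure on $\mathbb{R}$ such that for every finite Borel partition $\{B_1,\dots,B_k\}$ of $\mathbb{R}$ the random variables $\tilde\gamma(B_1),\dots,\tilde\gamma(B_k)$ are independent and $\tilde\gamma(B_j)$ has the gamma distribution with mean and variance both equal to $\alpha(B_j)$ (the point mass at $0$ if $\alpha(B_j)=0$). Let $\tilde\varphi$ be a Dirichlet process with parameter $\alpha$, i.e. a random probability measure on $\mathbb{R}$ such that for every finite Borel partition $\{C_1,\dots,C_{n+1}\}$ of $\mathbb{R}$ the vector $(\tilde\varphi(C_1),\dots,\tilde\varphi(C_n))$ has the Dirichlet distribution with parameter $(\alpha(C_1),\dots,\alpha(C_{n+1}))$ (coordinates with parameter $0$ being degenerate at $0$). Then the means $\tilde\gamma(I)=\int x\,\tilde\gamma(dx)$ and $\tilde\varphi(I)=\int x\,\tilde\varphi(dx)$ are almost surely well-defined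 finite random variables. Let $\mu_\alpha$ be the law of $\tilde\varphi(I)$. The law of $\tilde\gamma(I)$ is absolutely continuous with respect to Lebesgue measure on $\mathbb{R}$, and the function $$q(x)=\mathbb{I}_{(-\infty,0]}(x)\,\frac{|x|^{a-1}}{\Gamma(a)}\int_{(-\infty,0)}|y|^{-a}e^{-x/y}\,\mu_\alpha(dy)+\mathbb{I}_{(0,+\infty)}(x)\,\frac{x^{a-1}}{\Gamma(a)}\int_{(0,+\infty)}y^{-a}e^{-x/y}\,\mu_\alpha(dy)$$ (whose integrals are finite for every $x\neq0$; its value at the single point $x=0$ is immaterial) is a density of that law. -/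

import Mathlib

open MeasureTheory ProbabilityTheory

noncomputable section

/-- The finite Borel measures `α` on the real line with
total mass `a` and `∫ log (1 + |x|) α(dx) < ∞`. -/
def logMeasures (a : ℝ) : Set (FiniteMeasure ℝ) :=
  {α | (α : Measure ℝ).real Set.univ = a ∧
    Integrable (fun x : ℝ => Real.log (1 + |x|)) (α : Measure ℝ)}

/-- `C` is a finite partition of the real line into Borel sets (empty cells are allowed). -/
structure IsBorelPartition {k : ℕ} (C : Fin k → Set ℝ) : Prop where
  measurableSet : ∀ i, MeasurableSet (C i)
  pairwise_disjoint : Pairwise fun i j => Disjoint (C i) (C j)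
  iUnion_eq : ⋃ i, C i = Set.univ

/-- The gamma distribution with mean and variance both equal to `s ≥ 0`, i.e. shape `s` and rate
`1`; for `s = 0` it is the point mass at `0`. -/
def unitGammaLaw (s : ℝ) : Measure ℝ :=
  if s = 0 then Measure.dirac 0 else gammaMeasure s 1

/-- The open simplex `{u ∈ ℝⁿ : u_i > 0 for all i, ∑ u_i < 1}`. -/
def openSimplex (n : ℕ) : Set (Fin n → ℝ) :=
  {u | (∀ i, 0 < u i) ∧ ∑ i, u i < 1}

/-- The density of the Dirichlet distribution with (strictly positive) parameter
`(b_0, …, b_n)`, in the first `n` coordinates. -/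
def dirichletDensity {n : ℕ} (b : Fin (n + 1) → ℝ) (u : Fin n → ℝ) : ℝ :=
  (openSimplex n).indicator
    (fun u => Real.Gamma (∑ i, b i) / (∏ i, Real.Gamma (b i)) *
      ((∏ i : Fin n, u i ^ (b i.castSucc - 1)) *
        (1 - ∑ i, u i) ^ (b (Fin.last n) - 1))) u

/-- The Dirichlet distribution with strictly positive parameter `(b_0, …, b_n)`, as the law on
`ℝⁿ` of the first `n` coordinates. -/
def dirichletLaw {n : ℕ} (b : Fin (n + 1) → ℝ) : Measure (Fin n → ℝ) :=
  (volume : Measure (Fin n → ℝ)).withDensity fun u => ENNReal.ofReal (dirichletDensity b u)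

/-- A random finite measure `γ` on the real line has the functional gamma distribution with
parameter `α`: over every finite Borel partition the masses of the cells are independent, and the
mass of a cell `B` has the gamma distribution with mean and variance `α B`.
Measurability of `γ` is with respect to the `σ`-field generated by the evaluations `m ↦ m B`. -/
structure IsGammaProcess {Ω : Type*} [MeasurableSpace Ω] (P : Measure Ω)
    (α : FiniteMeasure ℝ) (γ : Ω → FiniteMeasure ℝ) : Prop where
  measurable : Measurable γ
  indep : ∀ (k : ℕ) (B : Fin k → Set ℝ), IsBorelPartition B →
    iIndepFun (fun i ω => (γ ω : Measure ℝ).real (B i)) P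
  law : ∀ (k : ℕ) (B : Fin k → Set ℝ), IsBorelPartition B → ∀ i,
    P.map (fun ω => (γ ω : Measure ℝ).real (B i)) = unitGammaLaw ((α : Measure ℝ).real (B i))

/-- A random probability measure `φ` on the real line is a (functional) Dirichlet process with
parameter `α`: over every finite Borel partition the masses of the cells have the Dirichlet
distribution whose parameter is the vector of the `α`-masses of the cells. As usual, coordinates
with parameter `0` are degenerate at `0`; they are covered by the field `null`. -/
structure IsDirichletProcess {Ω : Type*} [MeasurableSpace Ω] (P : Measure Ω)
    (α : FiniteMeasure ℝ) (φ : Ω → ProbabilityMeasure ℝ) : Prop where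
  measurable : Measurable φ
  null : ∀ B : Set ℝ, MeasurableSet B → (α : Measure ℝ) B = 0 →
    ∀ᵐ ω ∂P, (φ ω : Measure ℝ) B = 0
  law : ∀ (n : ℕ) (C : Fin (n + 1) → Set ℝ), IsBorelPartition C →
    (∀ i, 0 < (α : Measure ℝ).real (C i)) →
    P.map (fun ω (i : Fin n) => (φ ω : Measure ℝ).real (C i.castSucc)) =
      dirichletLaw fun i => (α : Measure ℝ).real (C i)

/-- The two-sided gamma-kernel mixture of a measure `μ` on the real line. -/
def gammaMixtureDensity (a : ℝ) (μ : Measure ℝ) (x : ℝ) : ℝ :=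
  (Set.Iic 0).indicator
      (fun x : ℝ => |x| ^ (a - 1) / Real.Gamma a *
        ∫ y in Set.Iio 0, |y| ^ (-a) * Real.exp (-x / y) ∂μ) x +
    (Set.Ioi 0).indicator
      (fun x : ℝ => x ^ (a - 1) / Real.Gamma a *
        ∫ y in Set.Ioi 0, y ^ (-a) * Real.exp (-x / y) ∂μ) x

end

/-! A gamma process has the law of a Dirichlet process multiplied by an independent gamma variable
`T` of shape `a`. Hence the mean of the gamma process is distributed as `T` times an independent
variable of law `μ`. Given that variable equal to `y ≠ 0`, the product has density `|y|⁻¹ *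
gammaKernel a (x / y)` at `x`; integrating over `μ` gives the mixture.

The factorization is needed only for integrals of simple functions, where it is the
finite-dimensional gamma–Dirichlet identity (`pi_gammaMeasure_eq_map`). `HasGammaIntegrals` records
what the gamma process and the rescaled Dirichlet process then share, and the analysis is done once
for both. Its engine is the formula of `norm_integral_exp`, `‖E exp (-z X)‖ = exp (-∫ log ‖1 + z f‖
dα)` for `X` the random integral of a simple `f`. With `z > 0` small, it shows that `∫ |x|` is
almost surely finite (`ae_lintegral_lt_top`). Simple approximations of the identity then show that
the two means have the same characteristic function (`map_integral_id_eq`). With `z` imaginary and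
large, it shows that this characteristic function vanishes at infinity as soon as `α` charges the
complement of `0` (`tendsto_charFun`). So the mean of the gamma process has no atom at `0`, hence
neither has `μ`, and the scaling by `y` is legitimate almost everywhere. -/

open scoped ENNReal

/-! ### Gamma–Dirichlet factorization in finite dimension -/

/-- The lower integral of a product of functions of one coordinate each. -/
theorem lintegral_pi_prod_fin {n : ℕ} (μ : Fin n → Measure ℝ) [∀ i, SigmaFinite (μ i)]
    (f : Fin n → ℝ → ℝ≥0∞) (hf : ∀ i, Measurable (f i)) :
    ∫⁻ x, ∏ i, f i (x i) ∂(Measure.pi μ) = ∏ i, ∫⁻ x, f i x ∂(μ i) := by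
  induction n with
  | zero => simp
  | succ n ih =>
    have h := measurePreserving_piFinSuccAbove μ 0
    rw [← (h.symm _).lintegral_comp (by fun_prop)]
    simp only [MeasurableEquiv.piFinSuccAbove_symm_apply, Fin.insertNthEquiv,
      Fin.insertNth_zero', Equiv.coe_fn_mk, Fin.prod_univ_succ, Fin.cons_zero, Fin.cons_succ,
      Fin.succAbove_zero]
    rw [lintegral_prod_mul (f := f 0) (g := fun y : Fin n → ℝ => ∏ i : Fin n, f i.succ (y i))
      (hf 0).aemeasurable (Finset.measurable_prod _ fun i _ =>
        (hf i.succ).comp (measurable_pi_apply i)).aemeasurable]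
    rw [ih (fun i => μ i.succ) (fun i => f i.succ) (fun i => hf _)]

theorem pi_withDensity_fin {n : ℕ} (f : Fin n → ℝ → ℝ≥0∞) (hf : ∀ i, Measurable (f i))
    (hσ : ∀ i, SigmaFinite (volume.withDensity (f i))) :
    Measure.pi (fun i => (volume : Measure ℝ).withDensity (f i)) =
      (volume : Measure (Fin n → ℝ)).withDensity fun x => ∏ i, f i (x i) := by
  refine (Measure.pi_eq fun s hs => ?_)
  rw [withDensity_apply _ (MeasurableSet.univ_pi hs), ← lintegral_indicator
    (MeasurableSet.univ_pi hs)]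
  have : (Set.univ.pi s).indicator (fun x : Fin n → ℝ => ∏ i, f i (x i)) =
      fun x => ∏ i, (s i).indicator (f i) (x i) := by
    ext x
    by_cases hx : x ∈ Set.univ.pi s
    · rw [Set.indicator_of_mem hx]
      exact Finset.prod_congr rfl fun i _ => (Set.indicator_of_mem (hx i trivial) _).symm
    · rw [Set.indicator_of_notMem hx]
      simp only [Set.mem_pi, Set.mem_univ, true_implies, not_forall] at hx
      obtain ⟨i, hi⟩ := hx
      exact (Finset.prod_eq_zero (Finset.mem_univ i) (Set.indicator_of_notMem hi _)).symm
  rw [this, volume_pi, lintegral_pi_prod_fin _ _ fun i => (hf i).indicator (hs i)]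
  exact Finset.prod_congr rfl fun i _ => by
    rw [withDensity_apply _ (hs i), lintegral_indicator (hs i)]

/-- The density of the gamma distribution of rate `1`, vanishing on the closed left half-line. -/
noncomputable def gammaKernel (b x : ℝ) : ℝ :=
  (Set.Ioi 0).indicator (fun x => x ^ (b - 1) * Real.exp (-x) / Real.Gamma b) x

theorem measurable_gammaKernel (b : ℝ) : Measurable (gammaKernel b) :=
  Measurable.indicator (by fun_prop) measurableSet_Ioi

theorem gammaKernel_of_pos (b : ℝ) {x : ℝ} (hx : 0 < x) :
    gammaKernel b x = x ^ (b - 1) * Real.exp (-x) / Real.Gamma b :=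
  Set.indicator_of_mem (s := Set.Ioi (0 : ℝ)) hx _

theorem gammaKernel_of_nonpos (b : ℝ) {x : ℝ} (hx : x ≤ 0) : gammaKernel b x = 0 :=
  Set.indicator_of_notMem (s := Set.Ioi (0 : ℝ)) (by simpa using hx) _

theorem gammaKernel_nonneg {b : ℝ} (hb : 0 < b) (x : ℝ) : 0 ≤ gammaKernel b x := by
  rcases le_or_gt x 0 with hx | hx
  · rw [gammaKernel_of_nonpos b hx]
  · rw [gammaKernel_of_pos b hx]
    have := Real.Gamma_pos_of_pos hb
    positivity

theorem gammaMeasure_one_eq_withDensity (b : ℝ) :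
    gammaMeasure b 1 = volume.withDensity fun x => ENNReal.ofReal (gammaKernel b x) := by
  rw [gammaMeasure]
  refine withDensity_congr_ae ?_
  have : ∀ᵐ x : ℝ, x ≠ 0 := by simp [ae_iff]
  filter_upwards [this] with x hx
  rw [gammaPDF_eq]
  rcases lt_or_gt_of_ne hx with h | h
  · rw [if_neg (not_le.2 h), gammaKernel_of_nonpos b h.le]
  · rw [if_pos h.le, gammaKernel_of_pos b h]
    congr 1
    simp only [Real.one_rpow, one_mul]
    ring

theorem measurable_dirichletDensity {n : ℕ} (b : Fin (n + 1) → ℝ) :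
    Measurable (dirichletDensity b) := by
  have : MeasurableSet (openSimplex n) := by
    unfold openSimplex
    refine (MeasurableSet.inter (s₁ := {u : Fin n → ℝ | ∀ i, 0 < u i})
      (s₂ := {u : Fin n → ℝ | ∑ i, u i < 1}) ?_ (measurableSet_lt
      (Finset.measurable_sum _ fun i _ => measurable_pi_apply i) measurable_const))
    simp only [Set.ofPred_forall]
    exact MeasurableSet.iInter fun i => measurableSet_lt measurable_const (measurable_pi_apply i)
  refine Measurable.indicator ?_ this
  fun_prop

/-- The change of variables from independent gammas to their sum `t` and proportions `u`: `t ^ n` is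
the Jacobian of `y = t • u`, the powers of `t` add up to `∑ b i - 1`, and the exponentials multiply
to `exp (-t)`. Outside the simplex both sides vanish. -/
theorem prod_gammaKernel_snoc {n : ℕ} (b : Fin (n + 1) → ℝ) (hb : ∀ i, 0 < b i) {t : ℝ}
    (ht : 0 < t) (u : Fin n → ℝ) :
    t ^ n * ∏ i, gammaKernel (b i) (Fin.snoc (α := fun _ => ℝ) (t • u) (t - ∑ i, (t • u) i) i) =
      gammaKernel (∑ i, b i) t * dirichletDensity b u := by
  have hsum : t - ∑ i, (t • u) i = t * (1 - ∑ i, u i) := by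
    simp [mul_sub, Finset.mul_sum]
  rw [hsum, Fin.prod_univ_castSucc]
  simp only [Fin.snoc_castSucc, Fin.snoc_last, Pi.smul_apply, smul_eq_mul]
  rw [dirichletDensity]
  by_cases hu : u ∈ openSimplex n
  · rw [Set.indicator_of_mem hu]
    obtain ⟨hu0, hu1⟩ := hu
    have hl : 0 < 1 - ∑ i, u i := by linarith
    rw [gammaKernel_of_pos _ ht, gammaKernel_of_pos _ (mul_pos ht hl),
      Finset.prod_congr rfl fun i _ => gammaKernel_of_pos _ (mul_pos ht (hu0 i))]
    simp only [Real.mul_rpow ht.le (hu0 _).le, Real.mul_rpow ht.le hl.le, Finset.prod_div_distrib,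
      Finset.prod_mul_distrib, ← Real.exp_sum]
    have h1 : Real.exp (∑ i, -(t * u i)) * Real.exp (-(t * (1 - ∑ i, u i))) = Real.exp (-t) := by
      rw [← Real.exp_add, Finset.sum_neg_distrib, ← Finset.mul_sum]; ring_nf
    have h2 : t ^ n * (∏ i : Fin n, t ^ (b i.castSucc - 1)) * t ^ (b (Fin.last n) - 1) =
        t ^ (∑ i, b i - 1) := by
      rw [← Real.rpow_sum_of_pos ht, ← Real.rpow_natCast, ← Real.rpow_add ht, ← Real.rpow_add ht,
        Fin.sum_univ_castSucc, Finset.sum_sub_distrib]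
      congr 1
      simp
      ring
    have hG : Real.Gamma (∑ i, b i) ≠ 0 :=
      (Real.Gamma_pos_of_pos (Finset.sum_pos (fun i _ => hb i) Finset.univ_nonempty)).ne'
    rw [← h1, ← h2, Fin.prod_univ_castSucc (fun i => Real.Gamma (b i))]
    field_simp
  · rw [Set.indicator_of_notMem hu, mul_zero]
    have : (∃ i, u i ≤ 0) ∨ 1 - ∑ i, u i ≤ 0 := by
      by_contra! h
      exact hu ⟨h.1, by linarith [h.2]⟩
    rcases this with ⟨i, hi⟩ | h
    · rw [Finset.prod_eq_zero (Finset.mem_univ i)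
        (gammaKernel_of_nonpos _ (mul_nonpos_of_nonneg_of_nonpos ht.le hi))]
      simp
    · rw [gammaKernel_of_nonpos _ (mul_nonpos_of_nonneg_of_nonpos ht.le h)]
      simp

theorem lintegral_eq_lintegral_comp_smul {n : ℕ} {t : ℝ} (ht : 0 < t)
    (H : (Fin n → ℝ) → ℝ≥0∞) (hH : Measurable H) :
    ∫⁻ y, H y = ENNReal.ofReal (t ^ n) * ∫⁻ u, H (t • u) := by
  have h := Measure.map_addHaar_smul (volume : Measure (Fin n → ℝ)) ht.ne'
  rw [← lintegral_map (μ := volume) (g := fun u : Fin n → ℝ => t • u) hH (by fun_prop), h]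
  rw [lintegral_smul_measure, Module.finrank_fin_fun, smul_eq_mul, ← mul_assoc,
    ← ENNReal.ofReal_mul (by positivity), abs_of_pos (by positivity), mul_inv_cancel₀ (by positivity)]
  simp

theorem measurable_snoc_rescale (n : ℕ) :
    Measurable fun p : ℝ × (Fin n → ℝ) =>
      (Fin.snoc (α := fun _ => ℝ) (p.1 • p.2) (p.1 - ∑ i, (p.1 • p.2) i) : Fin (n + 1) → ℝ) := by
  refine measurable_pi_lambda _ fun i => ?_
  refine Fin.lastCases ?_ (fun i => ?_) i
  · simp only [Fin.snoc_last]; fun_prop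
  · simp only [Fin.snoc_castSucc]; fun_prop

/-- Independent gamma variables are a gamma variable times an independent Dirichlet vector. -/
theorem pi_gammaMeasure_eq_map {n : ℕ} (b : Fin (n + 1) → ℝ) (hb : ∀ i, 0 < b i) :
    Measure.pi (fun i => gammaMeasure (b i) 1) =
      ((gammaMeasure (∑ i, b i) 1).prod (dirichletLaw b)).map fun p =>
        Fin.snoc (α := fun _ => ℝ) (p.1 • p.2) (p.1 - ∑ i, (p.1 • p.2) i) := by
  have hB : 0 < ∑ i, b i := Finset.sum_pos (fun i _ => hb i) Finset.univ_nonempty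
  have hprob : ∀ i, IsProbabilityMeasure (gammaMeasure (b i) 1) := fun i =>
    isProbabilityMeasure_gammaMeasure (hb i) one_pos
  refine Measure.ext_of_lintegral _ fun F hF => ?_
  have hFs := hF.comp (measurable_snoc_rescale n)
  simp only [Function.comp_def] at hFs
  rw [lintegral_map hF (measurable_snoc_rescale n), gammaMeasure_one_eq_withDensity, dirichletLaw,
    prod_withDensity (measurable_gammaKernel _).ennreal_ofReal
      (measurable_dirichletDensity b).ennreal_ofReal,
    lintegral_withDensity_eq_lintegral_mul _ (by
      have := measurable_gammaKernel (∑ i, b i)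
      have := measurable_dirichletDensity b
      fun_prop) hFs]
  have hker : ∀ i, Measurable fun x => ENNReal.ofReal (gammaKernel (b i) x) := fun i =>
    (measurable_gammaKernel _).ennreal_ofReal
  have hprod : Measurable fun x : Fin (n + 1) → ℝ =>
      ∏ i, ENNReal.ofReal (gammaKernel (b i) (x i)) :=
    Finset.measurable_prod _ fun i _ => (hker i).comp (measurable_pi_apply i)
  simp only [gammaMeasure_one_eq_withDensity] at hprob ⊢
  rw [pi_withDensity_fin _ hker (fun i => inferInstance),
    lintegral_withDensity_eq_lintegral_mul _ hprod hF]
  set G : (Fin (n + 1) → ℝ) → ℝ≥0∞ :=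
    (fun x => ∏ i, ENNReal.ofReal (gammaKernel (b i) (x i))) * F with hG
  have hGm : Measurable G := by
    exact hprod.mul hF
  have hsnoc : Measurable fun p : ℝ × (Fin n → ℝ) =>
      (Fin.snoc (α := fun _ => ℝ) p.2 p.1 : Fin (n + 1) → ℝ) := by
    refine measurable_pi_lambda _ fun i => ?_
    refine Fin.lastCases ?_ (fun i => ?_) i
    · simp only [Fin.snoc_last]; fun_prop
    · simp only [Fin.snoc_castSucc]; fun_prop
  have hmp := (volume_preserving_piFinSuccAbove (fun _ : Fin (n + 1) => ℝ) (Fin.last n)).symm _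
  have hval : ∀ p, (MeasurableEquiv.piFinSuccAbove (fun _ : Fin (n + 1) => ℝ) (Fin.last n)).symm p
      = Fin.snoc (α := fun _ => ℝ) p.2 p.1 := fun p => by
    simp [MeasurableEquiv.piFinSuccAbove_symm_apply, Fin.insertNthEquiv]
  rw [← hmp.lintegral_comp hGm]
  simp only [hval]
  have hGs := hGm.comp hsnoc
  simp only [Function.comp_def] at hGs
  rw [Measure.volume_eq_prod, lintegral_prod_symm _ hGs.aemeasurable]
  -- The last coordinate is traded for the total `t`; after exchanging the integrals, the other
  -- coordinates are rescaled by `t`.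
  have hshift : ∀ y : Fin n → ℝ, ∫⁻ s, G (Fin.snoc (α := fun _ => ℝ) y s) =
      ∫⁻ t, G (Fin.snoc (α := fun _ => ℝ) y (t - ∑ i, y i)) := fun y =>
    (lintegral_sub_right_eq_self (fun s => G (Fin.snoc (α := fun _ => ℝ) y s)) (∑ i, y i)).symm
  simp only [hshift]
  have hm2 : Measurable fun p : (Fin n → ℝ) × ℝ =>
      G (Fin.snoc (α := fun _ => ℝ) p.1 (p.2 - ∑ i, p.1 i)) :=
    hGm.comp (hsnoc.comp (f := fun p : (Fin n → ℝ) × ℝ => (p.2 - ∑ i, p.1 i, p.1)) (by fun_prop))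
  rw [lintegral_lintegral_swap (f := fun y t => G (Fin.snoc (α := fun _ => ℝ) y (t - ∑ i, y i)))
    hm2.aemeasurable]
  rw [lintegral_prod _ (by
    have := measurable_gammaKernel (∑ i, b i)
    have := measurable_dirichletDensity b
    have := hF.comp (measurable_snoc_rescale n)
    exact (Measurable.mul (by fun_prop) this).aemeasurable)]
  refine lintegral_congr fun t => ?_
  rcases le_or_gt t 0 with ht | ht
  -- Coordinates with a nonpositive sum cannot all be positive, so one of the kernels vanishes.
  · have h1 : ∀ y : Fin n → ℝ, G (Fin.snoc (α := fun _ => ℝ) y (t - ∑ i, y i)) = 0 := by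
      intro y
      have : (∃ i, y i ≤ 0) ∨ t - ∑ i, y i ≤ 0 := by
        by_contra! h
        have := Finset.sum_nonneg fun i (_ : i ∈ Finset.univ) => (h.1 i).le
        linarith [h.2]
      have hz : ∏ i, ENNReal.ofReal (gammaKernel (b i)
          (Fin.snoc (α := fun _ => ℝ) y (t - ∑ i, y i) i)) = 0 := by
        rcases this with ⟨i, hi⟩ | h
        · refine Finset.prod_eq_zero (Finset.mem_univ i.castSucc) ?_
          rw [Fin.snoc_castSucc, gammaKernel_of_nonpos _ hi, ENNReal.ofReal_zero]
        · refine Finset.prod_eq_zero (Finset.mem_univ (Fin.last n)) ?_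
          rw [Fin.snoc_last, gammaKernel_of_nonpos _ h, ENNReal.ofReal_zero]
      simp only [hG, Pi.mul_apply, hz, zero_mul]
    simp [h1, gammaKernel_of_nonpos _ ht]
  · have hm3 := hm2.comp (by fun_prop : Measurable fun y : Fin n → ℝ => (y, t))
    simp only [Function.comp_def] at hm3
    rw [lintegral_eq_lintegral_comp_smul ht _ hm3, ← lintegral_const_mul]
    · refine lintegral_congr fun u => ?_
      simp only [hG, Pi.mul_apply]
      rw [← mul_assoc, ← ENNReal.ofReal_prod_of_nonneg (fun i _ => gammaKernel_nonneg (hb i) _),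
        ← ENNReal.ofReal_mul (by positivity), prod_gammaKernel_snoc b hb ht u,
        ENNReal.ofReal_mul (gammaKernel_nonneg hB t)]
    · exact hGm.comp (hsnoc.comp (f := fun u : Fin n → ℝ => (t - ∑ i, (t • u) i, t • u))
        (by fun_prop))

/-! ### Exponential transforms of gamma laws -/

theorem integrable_exp_mul_gammaMeasure_one {b t : ℝ} (hb : 0 < b) (ht : t < 1) :
    Integrable (fun x => Real.exp (t * x)) (gammaMeasure b 1) ∧
      ∫ x, Real.exp (t * x) ∂(gammaMeasure b 1) = (1 - t) ^ (-b) := by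
  have hG := (Real.Gamma_pos_of_pos hb).ne'
  have h : (fun x : ℝ => gammaKernel b x • Real.exp (t * x)) = (Set.Ioi 0).indicator
      fun x : ℝ => (Real.Gamma b)⁻¹ * (x ^ (b - 1) * Real.exp (-((1 - t) * x))) := by
    ext x
    by_cases hx : x ∈ Set.Ioi (0 : ℝ)
    · rw [Set.indicator_of_mem hx, gammaKernel_of_pos b hx]
      rw [show -((1 - t) * x) = -x + t * x by ring, Real.exp_add, smul_eq_mul]
      ring
    · rw [Set.indicator_of_notMem hx, gammaKernel_of_nonpos b (by simpa using hx)]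
      simp
  have hval := Real.integral_rpow_mul_exp_neg_mul_Ioi hb (sub_pos.2 ht)
  have hpos : 0 < 1 - t := by linarith
  rw [gammaMeasure_one_eq_withDensity, integral_withDensity_eq_integral_toReal_smul
    (measurable_gammaKernel b).ennreal_ofReal (by simp),
    integrable_withDensity_iff_integrable_smul' (measurable_gammaKernel b).ennreal_ofReal (by simp)]
  simp only [ENNReal.toReal_ofReal (gammaKernel_nonneg hb _)]
  rw [h, integral_indicator measurableSet_Ioi, integral_const_mul, hval,
    integrable_indicator_iff measurableSet_Ioi]
  refine ⟨?_, ?_⟩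
  · refine Integrable.const_mul ?_ _
    refine Integrable.of_integral_ne_zero ?_
    rw [hval]
    positivity
  · rw [one_div, Real.inv_rpow hpos.le, Real.rpow_neg hpos.le]
    field_simp

/-- Analytic continuation from the real axis: on the half-plane `z.re < 1` the number `1 - z` stays
in the right half-plane, where the principal power is analytic. -/
theorem complexMGF_gammaMeasure_one {b : ℝ} (hb : 0 < b) {z : ℂ} (hz : z.re < 1) :
    complexMGF id (gammaMeasure b 1) z = (1 - z) ^ (-b : ℂ) := by
  have hsub : Set.Iio 1 ⊆ interior (integrableExpSet id (gammaMeasure b 1)) :=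
    interior_maximal (fun t ht => (integrable_exp_mul_gammaMeasure_one hb ht).1) isOpen_Iio
  have hconv : Convex ℝ {z : ℂ | z.re < 1} := convex_halfSpace_re_lt 1
  refine AnalyticOnNhd.eqOn_of_preconnected_of_frequently_eq (U := {z : ℂ | z.re < 1}) (z₀ := 0)
    (f := complexMGF id (gammaMeasure b 1)) (g := fun z => (1 - z) ^ (-b : ℂ)) ?_ ?_
    hconv.isPreconnected (by simp) ?_ hz
  · exact analyticOnNhd_complexMGF.mono fun z hz => hsub hz
  · intro z hz
    refine AnalyticAt.cpow (by fun_prop) (by fun_prop) (Or.inl ?_)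
    simpa using hz
  · have hreal : ∀ t : ℝ, t < 1 →
        complexMGF id (gammaMeasure b 1) t = (1 - t : ℂ) ^ (-b : ℂ) := fun t ht => by
      rw [complexMGF_ofReal, mgf]
      simp only [id]
      rw [(integrable_exp_mul_gammaMeasure_one hb ht).2, Complex.ofReal_cpow (by linarith)]
      simp
    -- The identity theorem needs agreement at points accumulating at `0` but different from it;
    -- small positive reals serve.
    have hT : Filter.Tendsto (fun t : ℝ => (t : ℂ)) (nhdsWithin 0 (Set.Ioi 0))
        (nhdsWithin 0 {0}ᶜ) := by
      refine tendsto_nhdsWithin_iff.2 ⟨?_, ?_⟩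
      · exact (Complex.continuous_ofReal.tendsto' 0 0 (by simp)).mono_left nhdsWithin_le_nhds
      · filter_upwards [self_mem_nhdsWithin] with t ht
        simpa using (ne_of_gt ht : t ≠ 0)
    refine hT.frequently (Filter.Eventually.frequently ?_)
    filter_upwards [nhdsWithin_le_nhds (Iio_mem_nhds one_pos)] with t ht using hreal t ht

/-- Passing to the modulus removes the argument of the complex power, leaving a real logarithm that
adds up over cells. Positive Laplace transforms and decay of characteristic functions need no more.
-/
theorem norm_integral_exp_gammaMeasure_one {b : ℝ} (hb : 0 < b) {z : ℂ} (hz : 0 ≤ z.re) :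
    ‖∫ t, Complex.exp (-z * t) ∂(gammaMeasure b 1)‖ = Real.exp (-(b * Real.log ‖1 + z‖)) := by
  have hz' : 1 + z ≠ 0 := fun h => by
    have := congrArg Complex.re h
    simp at this
    linarith
  have h := complexMGF_gammaMeasure_one hb (z := -z) (by simp; linarith)
  rw [complexMGF] at h
  simp only [id] at h
  rw [h, sub_neg_eq_add, show (-b : ℂ) = ((-b : ℝ) : ℂ) by simp, Complex.norm_cpow_real,
    Real.rpow_def_of_pos (norm_pos_iff.2 hz')]
  ring_nf

theorem norm_integral_exp_map_pi_gammaMeasure {n : ℕ} (b v : Fin n → ℝ) (hb : ∀ i, 0 < b i) {z : ℂ}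
    (hz : ∀ i, 0 ≤ (z * v i).re) :
    ‖∫ y, Complex.exp (-z * (y : ℝ))
        ∂((Measure.pi fun i => gammaMeasure (b i) 1).map fun x => ∑ i, v i * x i)‖ =
      Real.exp (-∑ i, b i * Real.log ‖1 + z * v i‖) := by
  have hprob : ∀ i, IsProbabilityMeasure (gammaMeasure (b i) 1) := fun i =>
    isProbabilityMeasure_gammaMeasure (hb i) one_pos
  rw [integral_map (Finset.measurable_sum _ fun i _ => (measurable_pi_apply i).const_mul _).aemeasurable
    (by fun_prop)]
  have : ∀ x : Fin n → ℝ, Complex.exp (-z * ((∑ i, v i * x i : ℝ) : ℂ)) =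
      ∏ i, Complex.exp (-(z * v i) * x i) := fun x => by
    rw [← Complex.exp_sum]
    push_cast
    rw [Finset.mul_sum]
    exact congrArg _ (Finset.sum_congr rfl fun i _ => by ring)
  simp only [this]
  rw [integral_fintype_prod_eq_prod (fun i (t : ℝ) => Complex.exp (-(z * v i) * t)), norm_prod,
    Finset.prod_congr rfl fun i _ => norm_integral_exp_gammaMeasure_one (hb i) (hz i),
    ← Real.exp_sum, Finset.sum_neg_distrib]

/-! ### Simple functions and partitions into cells of positive mass -/

theorem measurable_integral_of_measurable {Ω : Type*} [MeasurableSpace Ω] {κ : Ω → Measure ℝ}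
    (hκ : Measurable κ) {f : ℝ → ℝ} (hf : Measurable f) : Measurable fun ω => ∫ x, f x ∂(κ ω) := by
  have h := StronglyMeasurable.integral_kernel (κ := (⟨κ, hκ⟩ : Kernel Ω ℝ)) hf.stronglyMeasurable
  exact h.measurable

/-- A partition into cells of positive `α`-measure on each of which, off the null set `N`,
the function `f` is constant. -/
structure IsAdaptedPartition (α : Measure ℝ) (f : ℝ → ℝ) {n : ℕ} (C : Fin (n + 1) → Set ℝ)
    (v : Fin (n + 1) → ℝ) (N : Set ℝ) : Prop where
  isBorelPartition : IsBorelPartition C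
  pos : ∀ i, 0 < α.real (C i)
  measurableSet_null : MeasurableSet N
  null : α N = 0
  eq : ∀ i, ∀ x ∈ C i, x ∉ N → f x = v i
  mem_range : ∀ i, v i ∈ Set.range f

/-- The Dirichlet law is prescribed only for positive parameters, so level sets of zero mass cannot
be cells. They form the null set `N` and are merged into the cell of a value `v₀` whose level set
has positive mass; such a value exists because `α ≠ 0`. -/
theorem exists_isAdaptedPartition (α : Measure ℝ) [IsFiniteMeasure α] (hα : α ≠ 0)
    (f : SimpleFunc ℝ ℝ) : ∃ (n : ℕ) (C : Fin (n + 1) → Set ℝ) (v : Fin (n + 1) → ℝ) (N : Set ℝ),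
      IsAdaptedPartition α f C v N := by
  classical
  set V := f.range.filter fun c => 0 < α.real (f ⁻¹' {c}) with hV
  have hN : α (f ⁻¹' (↑V)ᶜ) = 0 := by
    have hsub : f ⁻¹' (↑V)ᶜ ⊆ ⋃ c ∈ f.range.filter fun c => ¬ 0 < α.real (f ⁻¹' {c}),
        f ⁻¹' {c} := by
      intro x hx
      simp only [Set.mem_iUnion]
      refine ⟨f x, ?_, rfl⟩
      simp only [hV, Finset.coe_filter, Set.mem_preimage, Set.mem_compl_iff, Set.mem_ofPred_eq] at hx
      simp only [Finset.mem_filter]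
      exact ⟨f.mem_range_self x, fun h => hx ⟨f.mem_range_self x, h⟩⟩
    refine measure_mono_null hsub ((measure_biUnion_null_iff (Finset.countable_toSet _)).2 ?_)
    intro c hc
    have h := (Finset.mem_filter.1 hc).2
    have : α.real (f ⁻¹' {c}) = 0 := le_antisymm (not_lt.1 h) measureReal_nonneg
    exact (measureReal_eq_zero_iff).1 this
  have hne : V.Nonempty := by
    rw [Finset.nonempty_iff_ne_empty]
    intro h
    rw [h] at hN
    simp at hN
    exact hα hN
  obtain ⟨v₀, hv₀⟩ := hne
  obtain ⟨n, hn⟩ : ∃ n, V.card = n + 1 := Nat.exists_eq_succ_of_ne_zero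
    (Finset.card_pos.2 ⟨v₀, hv₀⟩).ne'
  let e : V ≃ Fin (n + 1) := V.equivFinOfCardEq hn
  let f' : SimpleFunc ℝ ℝ := f.map fun c => if c ∈ V then c else v₀
  have hf' : ∀ x, f' x ∈ V := fun x => by
    simp only [f', SimpleFunc.map_apply]
    split_ifs with h
    · exact h
    · exact hv₀
  have hff' : ∀ x, x ∉ f ⁻¹' (↑V)ᶜ → f' x = f x := fun x hx => by
    have hx : f x ∈ V := by simpa using hx
    simp [f', SimpleFunc.map_apply, hx]
  refine ⟨n, fun i => f' ⁻¹' {(e.symm i : ℝ)}, fun i => (e.symm i : ℝ), f ⁻¹' (↑V)ᶜ, ?_⟩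
  refine ⟨⟨fun i => f'.measurableSet_preimage _, ?_, ?_⟩, ?_, f.measurableSet_preimage _, hN, ?_, ?_⟩
  · intro i j hij
    refine Disjoint.preimage _ (Set.disjoint_singleton.2 fun h => hij ?_)
    exact e.symm.injective (Subtype.ext h)
  · refine Set.eq_univ_of_forall fun x => Set.mem_iUnion.2 ⟨e ⟨f' x, hf' x⟩, ?_⟩
    simp
  · intro i
    have hi := (e.symm i).2
    refine lt_of_lt_of_le (Finset.mem_filter.1 hi).2 (measureReal_mono fun x hx => ?_)
    have hx : f x = e.symm i := hx
    have : f x ∈ V := by rw [hx]; exact hi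
    simp only [Set.mem_preimage, Set.mem_singleton_iff]
    rw [hff' x (by simpa using this), hx]
  · intro i x hx hxN
    rw [← hff' x hxN]
    exact hx
  -- Since each `v i` is a value of `f`, sign conditions on `f` pass to the `v i`.
  · intro i
    exact SimpleFunc.mem_range.1 (Finset.mem_filter.1 (e.symm i).2).1

theorem IsBorelPartition.sum_measureReal {n : ℕ} {C : Fin n → Set ℝ} (hC : IsBorelPartition C)
    (m : Measure ℝ) [IsFiniteMeasure m] : ∑ i, m.real (C i) = m.real Set.univ := by
  rw [← hC.iUnion_eq, measureReal_iUnion_fintype hC.pairwise_disjoint hC.measurableSet]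

/-- The measure `m` need only vanish on `N`, so this serves for `α` itself and for almost every
realization of the random measures. -/
theorem IsAdaptedPartition.integral_comp {α : Measure ℝ} {f : ℝ → ℝ} {n : ℕ}
    {C : Fin (n + 1) → Set ℝ} {v : Fin (n + 1) → ℝ} {N : Set ℝ}
    (h : IsAdaptedPartition α f C v N) (m : Measure ℝ) [IsFiniteMeasure m] (hm : m N = 0)
    (g : ℝ → ℝ) : ∫ x, g (f x) ∂m = ∑ i, m.real (C i) * g (v i) := by
  have hC := h.isBorelPartition
  have hae : (fun x => g (f x)) =ᵐ[m] fun x => ∑ i, (C i).indicator (fun _ => g (v i)) x := by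
    have : ∀ᵐ x ∂m, x ∉ N := measure_eq_zero_iff_ae_notMem.1 hm
    filter_upwards [this] with x hx
    obtain ⟨i, hi⟩ := Set.mem_iUnion.1 (hC.iUnion_eq ▸ Set.mem_univ x : x ∈ ⋃ i, C i)
    rw [Finset.sum_eq_single i, Set.indicator_of_mem hi, h.eq i x hi hx]
    · intro j _ hj
      exact Set.indicator_of_notMem (fun hj' => Set.disjoint_left.1 (hC.pairwise_disjoint hj) hj' hi) _
    · simp
  rw [integral_congr_ae hae, integral_finsetSum]
  · exact Finset.sum_congr rfl fun i _ => by
      rw [integral_indicator_const _ (hC.measurableSet i), smul_eq_mul]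
  · exact fun i _ => (integrable_const _).indicator (hC.measurableSet i)

/-! ### Integrals of simple functions against the two processes -/

section GammaProcess

variable {Ω : Type*} [MeasurableSpace Ω] {P : Measure Ω}
  {α : FiniteMeasure ℝ} {γ : Ω → FiniteMeasure ℝ}

theorem IsGammaProcess.measurable_coe (hγ : IsGammaProcess P α γ) :
    Measurable fun ω => (γ ω : Measure ℝ) := measurable_subtype_coe.comp hγ.measurable

/-- Apply the definition to the partition `{N, Nᶜ}`: the law with parameter `0` is the point mass at
`0`. -/
theorem IsGammaProcess.ae_null (hγ : IsGammaProcess P α γ) {N : Set ℝ} (hN : MeasurableSet N)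
    (h : (α : Measure ℝ) N = 0) : ∀ᵐ ω ∂P, (γ ω : Measure ℝ) N = 0 := by
  have hpart : IsBorelPartition ![N, Nᶜ] := by
    refine ⟨fun i => ?_, fun i j hij => ?_, ?_⟩
    · fin_cases i
      exacts [hN, hN.compl]
    · fin_cases i <;> fin_cases j <;> simp_all [disjoint_compl_right, disjoint_compl_left]
    · ext x
      simp [Fin.exists_fin_two, em]
  have hl := hγ.law 2 _ hpart 0
  have hm : Measurable fun ω => (γ ω : Measure ℝ).real N :=
    ((Measure.measurable_coe hN).comp hγ.measurable_coe).ennreal_toReal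
  simp only [Matrix.cons_val_zero, unitGammaLaw, measureReal_def, h, ENNReal.toReal_zero, if_true]
    at hl
  have h2 : ∀ᵐ y ∂(P.map fun ω => ((γ ω : Measure ℝ) N).toReal), y = 0 := by
    rw [hl]
    exact (ae_dirac_iff (p := fun y : ℝ => y = 0) (measurableSet_singleton (0 : ℝ))).2 rfl
  filter_upwards [ae_of_ae_map hm.aemeasurable h2] with ω hω
  exact (ENNReal.toReal_eq_zero_iff _).1 hω |>.resolve_right (measure_ne_top _ _)

theorem IsGammaProcess.map_integral [IsProbabilityMeasure P] (hγ : IsGammaProcess P α γ) {f : ℝ → ℝ} {n : ℕ}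
    {C : Fin (n + 1) → Set ℝ} {v : Fin (n + 1) → ℝ} {N : Set ℝ}
    (h : IsAdaptedPartition (α : Measure ℝ) f C v N) :
    P.map (fun ω => ∫ x, f x ∂(γ ω : Measure ℝ)) =
      (Measure.pi fun i => gammaMeasure ((α : Measure ℝ).real (C i)) 1).map
        fun x => ∑ i, v i * x i := by
  have hC := h.isBorelPartition
  have hm : ∀ i, Measurable fun ω => (γ ω : Measure ℝ).real (C i) := fun i =>
    ((Measure.measurable_coe (hC.measurableSet i)).comp hγ.measurable_coe).ennreal_toReal
  have hlaw := (iIndepFun_iff_map_fun_eq_pi_map fun i => (hm i).aemeasurable).1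
    (hγ.indep _ C hC)
  have : ∀ i, P.map (fun ω => (γ ω : Measure ℝ).real (C i)) =
      gammaMeasure ((α : Measure ℝ).real (C i)) 1 := fun i => by
    rw [hγ.law _ C hC i, unitGammaLaw, if_neg (h.pos i).ne']
  simp only [this] at hlaw
  rw [← hlaw, Measure.map_map (Finset.measurable_sum _ fun i _ =>
    (measurable_pi_apply i).const_mul _) (measurable_pi_lambda _ hm)]
  refine Measure.map_congr ?_
  filter_upwards [hγ.ae_null h.measurableSet_null h.null] with ω hω
  refine (h.integral_comp (γ ω : Measure ℝ) hω id).trans ?_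
  exact Finset.sum_congr rfl fun i _ => mul_comm _ _

end GammaProcess

section DirichletProcess

variable {Ω : Type*} [MeasurableSpace Ω] {P : Measure Ω}
  {α : FiniteMeasure ℝ} {φ : Ω → ProbabilityMeasure ℝ}

theorem IsDirichletProcess.measurable_coe (hφ : IsDirichletProcess P α φ) :
    Measurable fun ω => (φ ω : Measure ℝ) := measurable_subtype_coe.comp hφ.measurable

/-- The independent gamma factor turns the Dirichlet cell masses into independent gammas. The last
cell mass, absent from the Dirichlet vector, is one minus the others. -/
theorem IsDirichletProcess.map_mul_integral [IsProbabilityMeasure P]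
    (hφ : IsDirichletProcess P α φ) {f : ℝ → ℝ} {n : ℕ}
    {C : Fin (n + 1) → Set ℝ} {v : Fin (n + 1) → ℝ} {N : Set ℝ}
    (h : IsAdaptedPartition (α : Measure ℝ) f C v N) :
    ((gammaMeasure ((α : Measure ℝ).real Set.univ) 1).prod P).map
        (fun p => p.1 * ∫ x, f x ∂(φ p.2 : Measure ℝ)) =
      (Measure.pi fun i => gammaMeasure ((α : Measure ℝ).real (C i)) 1).map
        fun x => ∑ i, v i * x i := by
  have hC := h.isBorelPartition
  have hm : ∀ i, Measurable fun ω => (φ ω : Measure ℝ).real (C i) := fun i =>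
    ((Measure.measurable_coe (hC.measurableSet i)).comp hφ.measurable_coe).ennreal_toReal
  have hm' : Measurable fun ω (i : Fin n) => (φ ω : Measure ℝ).real (C i.castSucc) :=
    measurable_pi_lambda _ fun i => hm _
  have ha : 0 < (α : Measure ℝ).real Set.univ := by
    rw [← hC.sum_measureReal]
    exact Finset.sum_pos (fun i _ => h.pos i) Finset.univ_nonempty
  have := isProbabilityMeasure_gammaMeasure ha one_pos
  rw [pi_gammaMeasure_eq_map _ h.pos, hC.sum_measureReal, ← hφ.law n C hC h.pos]
  nth_rewrite 2 [← Measure.map_id (μ := gammaMeasure ((α : Measure ℝ).real Set.univ) 1)]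
  have hL : Measurable fun x : Fin (n + 1) → ℝ => ∑ i, v i * x i :=
    Finset.measurable_sum _ fun i _ => (measurable_pi_apply i).const_mul _
  rw [Measure.map_prod_map _ _ measurable_id hm', Measure.map_map hL (measurable_snoc_rescale n),
    Measure.map_map (hL.comp (measurable_snoc_rescale n)) (measurable_id.prodMap hm')]
  refine Measure.map_congr ?_
  have hnull := hφ.null N h.measurableSet_null h.null
  filter_upwards [Measure.quasiMeasurePreserving_snd.ae hnull] with p hp
  have hint := h.integral_comp (φ p.2 : Measure ℝ) hp id
  simp only [id] at hint
  rw [hint]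
  simp only [Function.comp, Prod.map, id, Fin.sum_univ_castSucc, Fin.snoc_castSucc, Fin.snoc_last,
    Pi.smul_apply, smul_eq_mul]
  have hs := hC.sum_measureReal (φ p.2 : Measure ℝ)
  rw [Fin.sum_univ_castSucc, probReal_univ] at hs
  rw [← Finset.mul_sum, eq_sub_of_add_eq' hs, mul_add, Finset.mul_sum]
  congr 1
  · exact Finset.sum_congr rfl fun i _ => by ring
  · ring

end DirichletProcess

/-! ### Finiteness and characteristic function of the mean -/

/-- The integrals of simple functions against the random finite measure `κ` are distributed as
those against a gamma process with parameter `α`. -/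
structure HasGammaIntegrals {Ω : Type*} [MeasurableSpace Ω] (P : Measure Ω) (α : Measure ℝ)
    (κ : Ω → Measure ℝ) : Prop where
  measurable : Measurable κ
  isFiniteMeasure : ∀ ω, IsFiniteMeasure (κ ω)
  map_integral : ∀ (f : SimpleFunc ℝ ℝ) (n : ℕ) (C : Fin (n + 1) → Set ℝ) (v : Fin (n + 1) → ℝ)
    (N : Set ℝ), IsAdaptedPartition α f C v N → P.map (fun ω => ∫ x, f x ∂(κ ω)) =
      (Measure.pi fun i => gammaMeasure (α.real (C i)) 1).map fun x => ∑ i, v i * x i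

theorem log_one_add_mul_le {c x : ℝ} (hc : 0 ≤ c) :
    Real.log (1 + c * |x|) ≤ Real.log (1 + c) + Real.log (1 + |x|) := by
  have := abs_nonneg x
  rw [← Real.log_mul (by positivity) (by positivity)]
  refine Real.log_le_log (by positivity) ?_
  nlinarith

theorem integrable_log_one_add_mul {α : Measure ℝ} [IsFiniteMeasure α]
    (hlog : Integrable (fun x : ℝ => Real.log (1 + |x|)) α) {c : ℝ} (hc : 0 ≤ c) :
    Integrable (fun x : ℝ => Real.log (1 + c * |x|)) α := by
  refine ((integrable_const (Real.log (1 + c))).add hlog).mono'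
    (Measurable.aestronglyMeasurable (by fun_prop)) ?_
  refine ae_of_all _ fun x => ?_
  rw [Real.norm_of_nonneg (Real.log_nonneg (by have := abs_nonneg x; nlinarith))]
  exact log_one_add_mul_le hc

namespace HasGammaIntegrals

variable {Ω : Type*} [MeasurableSpace Ω] {P : Measure Ω} {α : Measure ℝ} [IsFiniteMeasure α]
  {κ : Ω → Measure ℝ}

theorem norm_integral_exp (hκ : HasGammaIntegrals P α κ) (hα : α ≠ 0) (f : SimpleFunc ℝ ℝ) {z : ℂ}
    (hz : ∀ x, 0 ≤ (z * f x).re) :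
    ‖∫ ω, Complex.exp (-z * (∫ x, f x ∂(κ ω) : ℝ)) ∂P‖ =
      Real.exp (-∫ x, Real.log ‖1 + z * f x‖ ∂α) := by
  obtain ⟨n, C, v, N, h⟩ := exists_isAdaptedPartition α hα f
  have hm := measurable_integral_of_measurable hκ.measurable f.measurable
  have h1 := norm_integral_exp_map_pi_gammaMeasure (fun i => α.real (C i)) v h.pos (z := z)
    fun i => by
      obtain ⟨x, hx⟩ := h.mem_range i
      rw [← hx]
      exact hz x
  rw [← hκ.map_integral f n C v N h, integral_map hm.aemeasurable (by fun_prop)] at h1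
  rw [h1, h.integral_comp α h.null fun y : ℝ => Real.log ‖1 + z * y‖]

/-- For simple `0 ≤ f k ↑ |x|` with random integrals `X k`, one has `E exp (-s X k) ≥ exp (-∫ log (1
+ s |x|) dα)`. On the event `A` that `∫ |x|` is infinite, `exp (-s X k) → 0`, so the right side is
at most `P Aᶜ`. As `s → 0` it tends to `1` by the logarithmic moment. -/
theorem ae_lintegral_lt_top [IsProbabilityMeasure P] (hκ : HasGammaIntegrals P α κ) (hα : α ≠ 0)
    (hlog : Integrable (fun x : ℝ => Real.log (1 + |x|)) α) :
    ∀ᵐ ω ∂P, ∫⁻ x, ‖x‖ₑ ∂(κ ω) < ∞ := by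
  have hfin := hκ.isFiniteMeasure
  have hmeas : Measurable fun x : ℝ => ‖x‖ₑ := by fun_prop
  set F : ℕ → SimpleFunc ℝ ℝ≥0∞ := SimpleFunc.eapprox fun x : ℝ => ‖x‖ₑ with hF
  set f : ℕ → SimpleFunc ℝ ℝ := fun k => (F k).map ENNReal.toReal with hf
  have hF_le : ∀ k x, F k x ≤ ‖x‖ₑ := fun k x => by
    rw [← SimpleFunc.iSup_eapprox_apply hmeas x]
    exact le_iSup (fun n => SimpleFunc.eapprox (fun x : ℝ => ‖x‖ₑ) n x) k
  have hf_apply : ∀ k x, f k x = (F k x).toReal := fun k x => rfl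
  have hf0 : ∀ k x, 0 ≤ f k x := fun k x => ENNReal.toReal_nonneg
  have hf_le : ∀ k x, f k x ≤ |x| := fun k x => by
    rw [hf_apply, ← Real.norm_eq_abs, ← toReal_enorm]
    exact ENNReal.toReal_mono enorm_ne_top (hF_le k x)
  set A : Set Ω := {ω | ∫⁻ x, ‖x‖ₑ ∂(κ ω) = ∞} with hA
  have hAm : MeasurableSet A := ((Measure.measurable_lintegral hmeas).comp hκ.measurable)
    (measurableSet_singleton ∞)
  set X : ℕ → Ω → ℝ := fun k ω => ∫ x, f k x ∂(κ ω) with hX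
  have hXm : ∀ k, Measurable (X k) := fun k =>
    measurable_integral_of_measurable hκ.measurable (f k).measurable
  have hX0 : ∀ k ω, 0 ≤ X k ω := fun k ω => integral_nonneg fun x => hf0 k x
  have hX_eq : ∀ k ω, X k ω = (∫⁻ x, F k x ∂(κ ω)).toReal := fun k ω =>
    integral_toReal (F k).measurable.aemeasurable
      (ae_of_all _ fun x => SimpleFunc.eapprox_lt_top _ _ _)
  have hX_top : ∀ ω ∈ A, Filter.Tendsto (fun k => X k ω) Filter.atTop Filter.atTop := by
    intro ω hω
    have hT : Filter.Tendsto (fun k => ∫⁻ x, F k x ∂(κ ω)) Filter.atTop (nhds ∞) := by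
      have hω : ∫⁻ x, ‖x‖ₑ ∂(κ ω) = ∞ := hω
      rw [← hω]
      refine lintegral_tendsto_of_tendsto_of_monotone (fun k => (F k).measurable.aemeasurable)
        (ae_of_all _ fun x i j hij => SimpleFunc.monotone_eapprox _ hij x)
        (ae_of_all _ fun x => SimpleFunc.tendsto_eapprox hmeas x)
    refine Filter.tendsto_atTop.2 fun M => ?_
    filter_upwards [hT.eventually (lt_mem_nhds (ENNReal.ofReal_lt_top (r := M)))] with k hk
    rw [hX_eq]
    -- `toReal` sends `∞` to `0`, so finiteness is needed for `X k ω` to be large; a simple function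
    -- is integrable against a finite measure.
    have hne : ∫⁻ x, F k x ∂(κ ω) ≠ ∞ := by
      have hi : Integrable (f k) (κ ω) := (f k).integrable_of_isFiniteMeasure
      have := hi.2
      rw [hasFiniteIntegral_iff_enorm] at this
      refine ne_of_lt (lt_of_eq_of_lt (lintegral_congr fun x => ?_) this)
      rw [hf_apply, Real.enorm_of_nonneg ENNReal.toReal_nonneg,
        ENNReal.ofReal_toReal (SimpleFunc.eapprox_lt_top _ _ _).ne]
    exact (ENNReal.ofReal_le_iff_le_toReal hne).1 hk.le
  have hlower : ∀ s : ℝ, 0 < s → s ≤ 1 →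
      Real.exp (-∫ x, Real.log (1 + s * |x|) ∂α) ≤ P.real Aᶜ := by
    intro s hs hs1
    have hk : ∀ k, Real.exp (-∫ x, Real.log (1 + s * |x|) ∂α) ≤
        P.real Aᶜ + ∫ ω, A.indicator (fun ω => Real.exp (-s * X k ω)) ω ∂P := by
      intro k
      have h1 := hκ.norm_integral_exp hα (f k) (z := (s : ℂ)) fun x => by
        simpa using mul_nonneg hs.le (hf0 k x)
      have h2 : ∀ ω, Complex.exp (-(s : ℂ) * (∫ x, f k x ∂(κ ω) : ℝ)) =
          (Real.exp (-s * X k ω) : ℂ) := fun ω => by push_cast; rfl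
      simp only [h2] at h1
      rw [integral_complex_ofReal, Complex.norm_real,
        Real.norm_of_nonneg (integral_nonneg fun _ => (Real.exp_pos _).le)] at h1
      have h3 : ∀ x, ‖1 + (s : ℂ) * (f k x : ℂ)‖ = 1 + s * f k x := fun x => by
        have := mul_nonneg hs.le (hf0 k x)
        rw [← Complex.ofReal_mul, ← Complex.ofReal_one, ← Complex.ofReal_add, Complex.norm_real,
          Real.norm_of_nonneg (by linarith)]
      simp only [h3] at h1
      have hexp1 : ∀ ω, Real.exp (-s * X k ω) ≤ 1 := fun ω =>
        Real.exp_le_one_iff.2 (by have := mul_nonneg hs.le (hX0 k ω); linarith)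
      have hint : Integrable (fun ω => Real.exp (-s * X k ω)) P :=
        Integrable.of_bound (by have := hXm k; fun_prop) 1 (ae_of_all _ fun ω => by
          rw [Real.norm_of_nonneg (Real.exp_pos _).le]; exact hexp1 ω)
      have hle : ∫ x, Real.log (1 + s * f k x) ∂α ≤ ∫ x, Real.log (1 + s * |x|) ∂α := by
        refine integral_mono_of_nonneg (ae_of_all _ fun x => ?_)
          (integrable_log_one_add_mul hlog hs.le) (ae_of_all _ fun x => ?_)
        · exact Real.log_nonneg (by have := mul_nonneg hs.le (hf0 k x); linarith)
        · refine Real.log_le_log (by have := mul_nonneg hs.le (hf0 k x); linarith) ?_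
          have := mul_le_mul_of_nonneg_left (hf_le k x) hs.le
          linarith
      calc Real.exp (-∫ x, Real.log (1 + s * |x|) ∂α)
          ≤ Real.exp (-∫ x, Real.log (1 + s * f k x) ∂α) := Real.exp_le_exp.2 (by linarith)
        _ = ∫ ω, Real.exp (-s * X k ω) ∂P := h1.symm
        _ = ∫ ω in Aᶜ, Real.exp (-s * X k ω) ∂P + ∫ ω in A, Real.exp (-s * X k ω) ∂P := by
            rw [add_comm, integral_add_compl hAm hint]
        _ ≤ P.real Aᶜ + ∫ ω, A.indicator (fun ω => Real.exp (-s * X k ω)) ω ∂P := by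
            rw [integral_indicator hAm]
            gcongr
            have := setIntegral_mono_on hint.integrableOn (integrableOn_const (C := (1 : ℝ)))
              hAm.compl fun ω _ => hexp1 ω
            simpa using this
    have hlim : Filter.Tendsto (fun k => P.real Aᶜ +
        ∫ ω, A.indicator (fun ω => Real.exp (-s * X k ω)) ω ∂P) Filter.atTop
        (nhds (P.real Aᶜ + ∫ ω, (0 : ℝ) ∂P)) := by
      refine Filter.Tendsto.const_add _ (tendsto_integral_of_dominated_convergence (fun _ => 1)
        (fun k => ?_) (integrable_const _) (fun k => ae_of_all _ fun ω => ?_)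
        (ae_of_all _ fun ω => ?_))
      · have := hXm k
        exact (Measurable.indicator (by fun_prop) hAm).aestronglyMeasurable
      · refine (norm_indicator_le_norm_self _ _).trans ?_
        rw [Real.norm_of_nonneg (Real.exp_pos _).le]
        exact Real.exp_le_one_iff.2 (by have := mul_nonneg hs.le (hX0 k ω); linarith)
      · by_cases hω : ω ∈ A
        · simp only [Set.indicator_of_mem hω]
          exact Real.tendsto_exp_atBot.comp ((hX_top ω hω).const_mul_atTop_of_neg (by linarith))
        · simp only [Set.indicator_of_notMem hω]
          exact tendsto_const_nhds
    have := ge_of_tendsto' hlim hk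
    simpa using this
  -- Let `s = 1 / (m + 1)` tend to `0`, dominated by `log (1 + |x|)`.
  have hc : Filter.Tendsto (fun m : ℕ => Real.exp (-∫ x, Real.log (1 + (1 / ((m : ℝ) + 1)) * |x|) ∂α))
      Filter.atTop (nhds (Real.exp (-∫ x, (0 : ℝ) ∂α))) := by
    refine (Real.continuous_exp.tendsto _).comp (Filter.Tendsto.neg
      (tendsto_integral_of_dominated_convergence (fun x => Real.log (1 + |x|))
        (fun m => Measurable.aestronglyMeasurable (by fun_prop)) hlog (fun m => ae_of_all _ fun x => ?_) (ae_of_all _ fun x => ?_)))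
    · have h1 : 1 / ((m : ℝ) + 1) ≤ 1 := by
        rw [div_le_one (by positivity)]; linarith [(Nat.cast_nonneg m : (0 : ℝ) ≤ m)]
      have h0 : 0 ≤ 1 / ((m : ℝ) + 1) := by positivity
      have hx := abs_nonneg x
      have h2 := mul_nonneg h0 hx
      rw [Real.norm_of_nonneg (Real.log_nonneg (by linarith))]
      exact Real.log_le_log (by linarith) (by nlinarith)
    · have h1 : Filter.Tendsto (fun m : ℕ => 1 + 1 / ((m : ℝ) + 1) * |x|) Filter.atTop
          (nhds (1 + 0 * |x|)) :=
        (tendsto_one_div_add_atTop_nhds_zero_nat.mul_const _).const_add _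
      have h2 := (Real.continuousAt_log (by simp : (1 + 0 * |x| : ℝ) ≠ 0)).tendsto.comp h1
      simpa [Function.comp_def] using h2
  have hone : 1 ≤ P.real Aᶜ := by
    have := le_of_tendsto' hc fun m => hlower _ (by positivity) (by
      rw [div_le_one (by positivity)]; linarith [(Nat.cast_nonneg m : (0 : ℝ) ≤ m)])
    simpa using this
  rw [probReal_compl_eq_one_sub hAm] at hone
  have hA0 : P.real A = 0 := le_antisymm (by linarith) measureReal_nonneg
  have hA0' : P A = 0 := (measureReal_eq_zero_iff).1 hA0
  filter_upwards [measure_eq_zero_iff_ae_notMem.1 hA0'] with ω hω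
  exact lt_top_iff_ne_top.2 hω

theorem ae_integrable [IsProbabilityMeasure P] (hκ : HasGammaIntegrals P α κ) (hα : α ≠ 0)
    (hlog : Integrable (fun x : ℝ => Real.log (1 + |x|)) α) :
    ∀ᵐ ω ∂P, Integrable (fun x : ℝ => x) (κ ω) := by
  filter_upwards [hκ.ae_lintegral_lt_top hα hlog] with ω hω
  exact ⟨by fun_prop, hω⟩

/-- Simple functions converging to the identity and dominated by `2 * |x|`. -/
noncomputable def idApprox (k : ℕ) : SimpleFunc ℝ ℝ :=
  SimpleFunc.approxOn (fun x : ℝ => x) measurable_id Set.univ 0 (Set.mem_univ _) k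

theorem abs_idApprox_le (k : ℕ) (x : ℝ) : |idApprox k x| ≤ 2 * |x| := by
  have := SimpleFunc.norm_approxOn_zero_le (f := fun x : ℝ => x) measurable_id (Set.mem_univ 0) x k
  simp only [Real.norm_eq_abs] at this
  rw [idApprox]
  linarith

theorem tendsto_idApprox (x : ℝ) :
    Filter.Tendsto (fun k => idApprox k x) Filter.atTop (nhds x) :=
  SimpleFunc.tendsto_approxOn (f := fun x : ℝ => x) measurable_id (Set.mem_univ 0) (by simp)

/-- With `z = -s * I` the factor `exp (-z X)` is the character `exp (i s X)`. Almost sure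
integrability of the identity gives convergence of the random integrals by domination with `2 *
|x|`. -/
theorem tendsto_integral_exp [IsProbabilityMeasure P] (hκ : HasGammaIntegrals P α κ) (hα : α ≠ 0)
    (hlog : Integrable (fun x : ℝ => Real.log (1 + |x|)) α) (s : ℝ) :
    Filter.Tendsto (fun k => ∫ ω, Complex.exp (-(-s * Complex.I) *
        (∫ x, idApprox k x ∂(κ ω) : ℝ)) ∂P) Filter.atTop
      (nhds (charFun (P.map fun ω => ∫ x, x ∂(κ ω)) s)) := by
  have hm := measurable_integral_of_measurable hκ.measurable (f := fun x => x) measurable_id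
  rw [charFun_apply_real, integral_map hm.aemeasurable (by fun_prop)]
  refine tendsto_integral_of_dominated_convergence (fun _ => 1) (fun k => ?_) (integrable_const _)
    (fun k => ae_of_all _ fun ω => ?_) ?_
  · have := measurable_integral_of_measurable hκ.measurable (idApprox k).measurable
    exact Measurable.aestronglyMeasurable (by fun_prop)
  · rw [Complex.norm_exp]
    simp
  · filter_upwards [hκ.ae_integrable hα hlog] with ω hω
    have h1 : Filter.Tendsto (fun k => ∫ x, idApprox k x ∂(κ ω)) Filter.atTop
        (nhds (∫ x, x ∂(κ ω))) :=
      tendsto_integral_of_dominated_convergence (fun x => 2 * |x|)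
        (fun k => (idApprox k).measurable.aestronglyMeasurable) (hω.abs.const_mul 2)
        (fun k => ae_of_all _ fun x => abs_idApprox_le k x)
        (ae_of_all _ fun x => tendsto_idApprox x)
    have hcont : Continuous fun y : ℝ => Complex.exp (-(-s * Complex.I) * (y : ℂ)) := by fun_prop
    have h2 := (hcont.tendsto _).comp h1
    simp only [Function.comp_def] at h2
    convert h2 using 3
    ring

theorem norm_charFun [IsProbabilityMeasure P] (hκ : HasGammaIntegrals P α κ) (hα : α ≠ 0)
    (hlog : Integrable (fun x : ℝ => Real.log (1 + |x|)) α) (s : ℝ) :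
    ‖charFun (P.map fun ω => ∫ x, x ∂(κ ω)) s‖ =
      Real.exp (-∫ x, Real.log ‖1 + (-s * Complex.I) * (x : ℝ)‖ ∂α) := by
  refine tendsto_nhds_unique (hκ.tendsto_integral_exp hα hlog s).norm ?_
  have h1 : ∀ k, ‖∫ ω, Complex.exp (-(-s * Complex.I) * (∫ x, idApprox k x ∂(κ ω) : ℝ)) ∂P‖ =
      Real.exp (-∫ x, Real.log ‖1 + (-s * Complex.I) * (idApprox k x : ℝ)‖ ∂α) := fun k =>
    hκ.norm_integral_exp hα (idApprox k) fun x => by simp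
  simp only [h1]
  have hge : ∀ y : ℝ, 1 ≤ ‖1 + (-s * Complex.I) * (y : ℂ)‖ := fun y => by
    have := Complex.abs_re_le_norm (1 + (-s * Complex.I) * (y : ℂ))
    simpa using this
  refine (Real.continuous_exp.tendsto _).comp (Filter.Tendsto.neg
    (tendsto_integral_of_dominated_convergence (fun x => Real.log (1 + (2 * |s|) * |x|))
      (fun k => ?_) (integrable_log_one_add_mul hlog (by positivity))
      (fun k => ae_of_all _ fun x => ?_) (ae_of_all _ fun x => ?_)))
  · have := (idApprox k).measurable
    exact Measurable.aestronglyMeasurable (by fun_prop)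
  · rw [Real.norm_of_nonneg (Real.log_nonneg (hge _))]
    refine Real.log_le_log (by linarith [hge (idApprox k x)]) ?_
    refine (norm_add_le _ _).trans ?_
    have := mul_le_mul_of_nonneg_left (abs_idApprox_le k x) (abs_nonneg s)
    simp
    linarith
  · have hcont : Continuous fun y : ℝ => ‖1 + (-s * Complex.I) * (y : ℂ)‖ := by fun_prop
    refine (Real.continuousAt_log (by linarith [hge x])).tendsto.comp ?_
    exact (hcont.tendsto x).comp (tendsto_idApprox x)

/-- Both characteristic functions are limits of the same sequence, since integrals of a simple
function have the same law under either random measure. -/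
theorem map_integral_id_eq [IsProbabilityMeasure P] {Ω' : Type*} [MeasurableSpace Ω'] {P' : Measure Ω'}
    [IsProbabilityMeasure P'] {κ' : Ω' → Measure ℝ} (hκ : HasGammaIntegrals P α κ)
    (hκ' : HasGammaIntegrals P' α κ') (hα : α ≠ 0)
    (hlog : Integrable (fun x : ℝ => Real.log (1 + |x|)) α) :
    (P.map fun ω => ∫ x, x ∂(κ ω)) = P'.map fun ω => ∫ x, x ∂(κ' ω) := by
  have hm := measurable_integral_of_measurable hκ.measurable (f := fun x => x) measurable_id
  have hm' := measurable_integral_of_measurable hκ'.measurable (f := fun x => x) measurable_id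
  have := Measure.isProbabilityMeasure_map hm.aemeasurable (μ := P)
  have := Measure.isProbabilityMeasure_map hm'.aemeasurable (μ := P')
  refine Measure.ext_of_charFun (funext fun s => ?_)
  refine tendsto_nhds_unique (hκ.tendsto_integral_exp hα hlog s) ?_
  convert hκ'.tendsto_integral_exp hα hlog s using 2 with k
  have h1 := measurable_integral_of_measurable hκ.measurable (idApprox k).measurable
  have h1' := measurable_integral_of_measurable hκ'.measurable (idApprox k).measurable
  obtain ⟨n, C, v, N, h⟩ := exists_isAdaptedPartition α hα (idApprox k)
  have h2 := (hκ.map_integral _ n C v N h).trans (hκ'.map_integral _ n C v N h).symm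
  rw [← integral_map (f := fun y : ℝ => Complex.exp (-(-s * Complex.I) * (y : ℂ)))
    h1.aemeasurable (by fun_prop), h2, integral_map h1'.aemeasurable (by fun_prop)]

/-- Some set `{δ ≤ |x|}` has positive mass `c`. There `‖1 - i s x‖ ≥ |s| δ`, so the characteristic
function at `s` is at most `(|s| δ) ^ (-c)` in modulus once `|s| δ ≥ 1`. -/
theorem tendsto_charFun [IsProbabilityMeasure P] (hκ : HasGammaIntegrals P α κ)
    (hlog : Integrable (fun x : ℝ => Real.log (1 + |x|)) α) (hα0 : α {0}ᶜ ≠ 0) {u : ℝ}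
    (hu : u ≠ 0) : Filter.Tendsto
      (fun k : ℕ => charFun (P.map fun ω => ∫ x, x ∂(κ ω)) (k * u)) Filter.atTop (nhds 0) := by
  have hα : α ≠ 0 := fun h => hα0 (by simp [h])
  obtain ⟨m, hm⟩ : ∃ m : ℕ, α {x : ℝ | 1 / ((m : ℝ) + 1) ≤ |x|} ≠ 0 := by
    by_contra! h
    refine hα0 (measure_mono_null (fun x hx => ?_) (measure_iUnion_null h))
    obtain ⟨m, hm⟩ := exists_nat_one_div_lt (abs_pos.2 hx)
    exact Set.mem_iUnion.2 ⟨m, hm.le⟩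
  set δ : ℝ := 1 / ((m : ℝ) + 1) with hδ
  have hδ0 : 0 < δ := by positivity
  set c := α.real {x : ℝ | δ ≤ |x|} with hc
  have hc0 : 0 < c := lt_of_le_of_ne measureReal_nonneg fun h =>
    hm ((measureReal_eq_zero_iff).1 h.symm)
  have hlin : Filter.Tendsto (fun k : ℕ => |k * u| * δ) Filter.atTop Filter.atTop := by
    simp only [abs_mul, Nat.abs_cast, mul_assoc]
    exact Filter.Tendsto.atTop_mul_const (by positivity) tendsto_natCast_atTop_atTop
  have hbound : Filter.Tendsto (fun k : ℕ => Real.exp (-(Real.log (|k * u| * δ) * c)))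
      Filter.atTop (nhds 0) :=
    Real.tendsto_exp_neg_atTop_nhds_zero.comp
      ((Real.tendsto_log_atTop.comp hlin).atTop_mul_const hc0)
  refine squeeze_zero_norm' ?_ hbound
  filter_upwards [hlin.eventually_ge_atTop 1] with k hk
  rw [hκ.norm_charFun hα hlog]
  refine Real.exp_le_exp.2 (neg_le_neg ?_)
  set s : ℝ := k * u with hs
  have hge : ∀ y : ℝ, 1 ≤ ‖1 + (-s * Complex.I) * (y : ℂ)‖ := fun y => by
    have := Complex.abs_re_le_norm (1 + (-s * Complex.I) * (y : ℂ))
    simpa using this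
  have hint : Integrable (fun x : ℝ => Real.log ‖1 + (-s * Complex.I) * (x : ℂ)‖) α := by
    refine (integrable_log_one_add_mul hlog (abs_nonneg s)).mono'
      (Measurable.aestronglyMeasurable (by fun_prop)) (ae_of_all _ fun x => ?_)
    rw [Real.norm_of_nonneg (Real.log_nonneg (hge _))]
    refine Real.log_le_log (by linarith [hge x]) ((norm_add_le _ _).trans ?_)
    simp
  refine le_trans ?_ (mul_meas_ge_le_integral_of_nonneg
    (ae_of_all _ fun x => Real.log_nonneg (hge x)) hint (Real.log (|s| * δ)))
  refine mul_le_mul_of_nonneg_left (measureReal_mono fun x hx => ?_) (Real.log_nonneg hk)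
  refine Real.log_le_log (by linarith) ?_
  have := Complex.abs_im_le_norm (1 + (-s * Complex.I) * (x : ℂ))
  refine le_trans ?_ this
  have h2 := mul_le_mul_of_nonneg_left hx (abs_nonneg s)
  simpa [abs_mul] using h2

end HasGammaIntegrals

/-! ### Absence of an atom at the origin -/

/-- A probability measure whose characteristic function vanishes at infinity along every
ray has no atom at the origin. -/
theorem measure_singleton_zero_of_tendsto_charFun (ν : Measure ℝ) [IsProbabilityMeasure ν]
    (h : ∀ u : ℝ, u ≠ 0 → Filter.Tendsto (fun k : ℕ => charFun ν (k * u)) Filter.atTop (nhds 0)) :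
    ν {0} = 0 := by
  have hna : NullSingletonClass (gaussianReal 0 1) := nullSingletonClass_gaussianReal one_ne_zero
  -- Averaging over a standard Gaussian `u` and exchanging integrals turns `charFun ν (k * u)` into
  -- `∫ exp (-(k x)² / 2) dν`, whose integrand is nonnegative and equals `1` at `x = 0`.
  have hle : ∀ k : ℕ, ν.real {0} ≤ ‖∫ u, charFun ν (k * u) ∂(gaussianReal 0 1)‖ := by
    intro k
    have h1 : ∫ u, charFun ν (k * u) ∂(gaussianReal 0 1) =
        ((∫ x : ℝ, Real.exp (-(k * x) ^ 2 / 2) ∂ν : ℝ) : ℂ) := by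
      simp only [charFun_apply_real]
      rw [integral_integral_swap]
      · rw [← integral_complex_ofReal]
        refine integral_congr_ae (ae_of_all _ fun x => ?_)
        have := charFun_gaussianReal (μ := 0) (v := 1) (k * x)
        rw [charFun_apply_real] at this
        push_cast at this ⊢
        simp only [mul_zero, zero_mul, zero_sub, one_mul] at this
        rw [neg_div, ← this]
        refine integral_congr_ae (ae_of_all _ fun u => ?_)
        ring_nf
      · refine Integrable.of_bound (by fun_prop) 1 (ae_of_all _ fun p => ?_)
        simp only [Function.uncurry]
        rw [← Complex.ofReal_mul, Complex.norm_exp_ofReal_mul_I]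
    rw [h1, Complex.norm_real, Real.norm_of_nonneg (integral_nonneg fun _ => (Real.exp_pos _).le)]
    rw [← integral_indicator_one (measurableSet_singleton (0 : ℝ))]
    refine integral_mono_of_nonneg (ae_of_all _ fun x => Set.indicator_nonneg (by simp) _) ?_
      (ae_of_all _ fun x => ?_)
    · refine Integrable.of_bound (by fun_prop) 1 (ae_of_all _ fun x => ?_)
      rw [Real.norm_of_nonneg (Real.exp_pos _).le]
      exact Real.exp_le_one_iff.2 (by have := sq_nonneg ((k : ℝ) * x); linarith)
    · refine Set.indicator_le' (s := {(0 : ℝ)}) (g := fun x => Real.exp (-(k * x) ^ 2 / 2))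
        (fun x hx => ?_) (fun x _ => (Real.exp_pos _).le) x
      have : x = 0 := hx
      simp [this]
  have hlim : Filter.Tendsto (fun k : ℕ => ‖∫ u, charFun ν (k * u) ∂(gaussianReal 0 1)‖)
      Filter.atTop (nhds ‖∫ u, (0 : ℂ) ∂(gaussianReal 0 1)‖) := by
    refine (tendsto_integral_of_dominated_convergence (fun _ => 1) (fun k => ?_)
      (integrable_const _) (fun k => ae_of_all _ fun u => norm_charFun_le_one _) ?_).norm
    · exact (measurable_charFun.comp (measurable_const_mul (k : ℝ))).aestronglyMeasurable
    · filter_upwards [measure_eq_zero_iff_ae_notMem.1 (measure_singleton (μ := gaussianReal 0 1) (0 : ℝ))]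
        with u hu using h u hu
  have := ge_of_tendsto' hlim hle
  simp only [integral_zero, norm_zero] at this
  exact (measureReal_eq_zero_iff).1 (le_antisymm this measureReal_nonneg)

/-! ### Both processes as instances of the common setting -/

theorem ae_pos_gammaMeasure_one (b : ℝ) : ∀ᵐ t ∂(gammaMeasure b 1), 0 < t := by
  rw [gammaMeasure_one_eq_withDensity, ae_withDensity_iff (measurable_gammaKernel b).ennreal_ofReal]
  refine ae_of_all _ fun t ht => ?_
  by_contra! h
  exact ht (by rw [gammaKernel_of_nonpos b h, ENNReal.ofReal_zero])

theorem IsGammaProcess.hasGammaIntegrals {Ω : Type*} [MeasurableSpace Ω] {P : Measure Ω}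
    [IsProbabilityMeasure P] {α : FiniteMeasure ℝ} {γ : Ω → FiniteMeasure ℝ}
    (hγ : IsGammaProcess P α γ) : HasGammaIntegrals P (α : Measure ℝ) fun ω => (γ ω : Measure ℝ) :=
  ⟨hγ.measurable_coe, fun _ => inferInstance, fun _ _ _ _ _ h => hγ.map_integral h⟩

theorem integral_ofReal_smul {m : Measure ℝ} {t : ℝ} (ht : 0 < t) (f : ℝ → ℝ) :
    ∫ x, f x ∂(ENNReal.ofReal t • m) = t * ∫ x, f x ∂m := by
  rw [integral_smul_measure, ENNReal.toReal_ofReal ht.le, smul_eq_mul]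

/-- A Dirichlet process multiplied by an independent gamma variable. -/
theorem IsDirichletProcess.hasGammaIntegrals {Ω : Type*} [MeasurableSpace Ω] {P : Measure Ω}
    [IsProbabilityMeasure P] {α : FiniteMeasure ℝ} {φ : Ω → ProbabilityMeasure ℝ}
    (hφ : IsDirichletProcess P α φ) :
    HasGammaIntegrals ((gammaMeasure ((α : Measure ℝ).real Set.univ) 1).prod P) (α : Measure ℝ)
      fun p => ENNReal.ofReal p.1 • (φ p.2 : Measure ℝ) := by
  refine ⟨?_, fun p => Measure.smul_finite _ ENNReal.ofReal_ne_top, fun f n C v N h => ?_⟩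
  · refine Measure.measurable_of_measurable_coe _ fun s hs => ?_
    simp only [Measure.smul_apply, smul_eq_mul]
    have := ((Measure.measurable_coe hs).comp hφ.measurable_coe).comp
      (measurable_snd : Measurable (Prod.snd : ℝ × Ω → Ω))
    exact (ENNReal.measurable_ofReal.comp measurable_fst).mul this
  · rw [← hφ.map_mul_integral h]
    refine Measure.map_congr ?_
    filter_upwards [Measure.quasiMeasurePreserving_fst.ae (ae_pos_gammaMeasure_one _)] with p hp
    exact integral_ofReal_smul hp f

/-! ### The gamma mixture density -/

/-- Raise `r / a ≤ exp (r / a)` to the power `a`. -/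
theorem rpow_mul_exp_neg_le {a r : ℝ} (ha : 0 < a) (hr : 0 < r) :
    r ^ a * Real.exp (-r) ≤ a ^ a := by
  have h1 : r ≤ a * Real.exp (r / a) := by
    have h2 := Real.add_one_le_exp (r / a)
    have h3 : r = a * (r / a) := by field_simp
    nlinarith
  have h4 := Real.rpow_le_rpow hr.le h1 ha.le
  rw [Real.mul_rpow ha.le (Real.exp_pos _).le, ← Real.exp_mul, div_mul_cancel₀ _ ha.ne'] at h4
  calc r ^ a * Real.exp (-r) ≤ a ^ a * Real.exp r * Real.exp (-r) := by gcongr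
    _ = a ^ a := by rw [mul_assoc, ← Real.exp_add]; simp

/-- With `r = x / y > 0` the integrand is `|x| ^ (-a) * r ^ a * exp (-r)`, bounded uniformly in `y`.
The singularity at `y = 0` is thus harmless for any finite `μ`. -/
theorem integrableOn_rpow_mul_exp {a x : ℝ} (ha : 0 < a) (μ : Measure ℝ) [IsFiniteMeasure μ]
    {s : Set ℝ} (hs : MeasurableSet s) (hx : ∀ y ∈ s, 0 < x / y) :
    IntegrableOn (fun y : ℝ => |y| ^ (-a) * Real.exp (-x / y)) s μ := by
  refine Integrable.of_bound (Measurable.aestronglyMeasurable (by fun_prop)) (|x| ^ (-a) * a ^ a) ?_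
  filter_upwards [ae_restrict_mem hs] with y hy
  have hr := hx y hy
  have hy0 : y ≠ 0 := fun h => by simp [h] at hr
  have hx0 : x ≠ 0 := fun h => by simp [h] at hr
  have h1 : |y| ^ (-a) = |x| ^ (-a) * (x / y) ^ a := by
    rw [← abs_of_pos hr, abs_div, Real.div_rpow (abs_nonneg _) (abs_nonneg _),
      Real.rpow_neg (abs_nonneg _), Real.rpow_neg (abs_nonneg _)]
    have := (Real.rpow_pos_of_pos (abs_pos.2 hx0) a).ne'
    field_simp
  rw [Real.norm_of_nonneg (by positivity), h1, mul_assoc, neg_div]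
  gcongr
  exact rpow_mul_exp_neg_le ha hr

theorem inv_mul_gammaKernel_div {a x y : ℝ} (hxy : 0 < x / y) :
    |y|⁻¹ * gammaKernel a (x / y) =
      |x| ^ (a - 1) / Real.Gamma a * (|y| ^ (-a) * Real.exp (-x / y)) := by
  have hy0 : y ≠ 0 := fun h => by simp [h] at hxy
  rw [gammaKernel_of_pos a hxy]
  have h1 : |y|⁻¹ * (x / y) ^ (a - 1) = |x| ^ (a - 1) * |y| ^ (-a) := by
    rw [← abs_of_pos hxy, abs_div, Real.div_rpow (abs_nonneg _) (abs_nonneg _),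
      Real.rpow_sub_one (abs_pos.2 hy0).ne', Real.rpow_neg (abs_nonneg _)]
    have := (Real.rpow_pos_of_pos (abs_pos.2 hy0) a).ne'
    have := (abs_pos.2 hy0).ne'
    field_simp
  rw [neg_div]
  calc |y|⁻¹ * ((x / y) ^ (a - 1) * Real.exp (-(x / y)) / Real.Gamma a)
      = (|y|⁻¹ * (x / y) ^ (a - 1)) * Real.exp (-(x / y)) / Real.Gamma a := by ring
    _ = _ := by rw [h1]; ring

/-- The set `s` is the half-line of those `y` with the sign of `x`; elsewhere the kernel is zero,
which produces the two sides of the mixture. -/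
theorem lintegral_inv_mul_gammaKernel {a x : ℝ} (ha : 0 < a) (μ : Measure ℝ) [IsFiniteMeasure μ]
    {s : Set ℝ} (hs : MeasurableSet s) (hx : ∀ y, y ∈ s ↔ 0 < x / y) :
    ∫⁻ y, ENNReal.ofReal (|y|⁻¹ * gammaKernel a (x / y)) ∂μ =
      ENNReal.ofReal (|x| ^ (a - 1) / Real.Gamma a *
        ∫ y in s, |y| ^ (-a) * Real.exp (-x / y) ∂μ) := by
  have hG := Real.Gamma_pos_of_pos ha
  rw [← integral_const_mul, ofReal_integral_eq_lintegral_ofReal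
    ((integrableOn_rpow_mul_exp ha μ hs fun y => (hx y).1).const_mul _)
    (ae_of_all _ fun y => by simp only [Pi.zero_apply]; positivity), ← lintegral_indicator hs]
  refine lintegral_congr fun y => ?_
  by_cases hy : y ∈ s
  · rw [Set.indicator_of_mem hy, inv_mul_gammaKernel_div ((hx y).1 hy)]
  · rw [Set.indicator_of_notMem hy, gammaKernel_of_nonpos a (not_lt.1 fun h => hy ((hx y).2 h)),
      mul_zero, ENNReal.ofReal_zero]

theorem lintegral_inv_mul_gammaKernel_eq_gammaMixtureDensity {a x : ℝ} (ha : 0 < a) (hx : x ≠ 0)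
    (μ : Measure ℝ) [IsFiniteMeasure μ] :
    ∫⁻ y, ENNReal.ofReal (|y|⁻¹ * gammaKernel a (x / y)) ∂μ =
      ENNReal.ofReal (gammaMixtureDensity a μ x) := by
  rcases lt_or_gt_of_ne hx with h | h
  · rw [lintegral_inv_mul_gammaKernel ha μ measurableSet_Iio fun y => ?_, gammaMixtureDensity,
      Set.indicator_of_mem (Set.mem_Iic.2 h.le), Set.indicator_of_notMem (by simpa using h.le),
      add_zero]
    simp [div_pos_iff, h, h.not_gt]
  · rw [lintegral_inv_mul_gammaKernel ha μ measurableSet_Ioi fun y => ?_, gammaMixtureDensity,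
      Set.indicator_of_mem (Set.mem_Ioi.2 h), Set.indicator_of_notMem (by simpa using h),
      zero_add, abs_of_pos h]
    · congr 2
      exact setIntegral_congr_fun measurableSet_Ioi fun y hy => by
        simp only [abs_of_pos (Set.mem_Ioi.1 hy)]
    · simp [h]

theorem measurable_gammaMixtureDensity (a : ℝ) (μ : Measure ℝ) [IsFiniteMeasure μ] :
    Measurable (gammaMixtureDensity a μ) := by
  have h1 : Measurable fun x : ℝ => ∫ y in Set.Iio 0, |y| ^ (-a) * Real.exp (-x / y) ∂μ :=
    (StronglyMeasurable.integral_prod_right (f := fun x y : ℝ => |y| ^ (-a) * Real.exp (-x / y))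
      (Measurable.stronglyMeasurable (by simp only [Function.uncurry_def]; fun_prop))).measurable
  have h2 : Measurable fun x : ℝ => ∫ y in Set.Ioi 0, y ^ (-a) * Real.exp (-x / y) ∂μ :=
    (StronglyMeasurable.integral_prod_right (f := fun x y : ℝ => y ^ (-a) * Real.exp (-x / y))
      (Measurable.stronglyMeasurable (by simp only [Function.uncurry_def]; fun_prop))).measurable
  refine Measurable.add (Measurable.indicator ?_ measurableSet_Iic)
    (Measurable.indicator ?_ measurableSet_Ioi)
  · exact Measurable.mul (by fun_prop) h1
  · exact Measurable.mul (by fun_prop) h2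

/-- The product of a gamma variable with an independent variable without atom at the origin has
the gamma mixture density. -/
theorem map_mul_gammaMeasure_prod {a : ℝ} (ha : 0 < a) (μ : Measure ℝ) [IsFiniteMeasure μ]
    (hμ : μ {0} = 0) : ((gammaMeasure a 1).prod μ).map (fun p => p.1 * p.2) =
      volume.withDensity fun x => ENNReal.ofReal (gammaMixtureDensity a μ x) := by
  have hprob := isProbabilityMeasure_gammaMeasure ha one_pos
  have hk := measurable_gammaKernel a
  refine Measure.ext_of_lintegral _ fun F hF => ?_
  rw [lintegral_map hF (by fun_prop), lintegral_prod_symm _ (by fun_prop),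
    lintegral_withDensity_eq_lintegral_mul _ (measurable_gammaMixtureDensity a μ).ennreal_ofReal hF]
  have hscale : ∀ᵐ y ∂μ, ∫⁻ t, F (t * y) ∂(gammaMeasure a 1) =
      ∫⁻ x, ENNReal.ofReal (|y|⁻¹ * gammaKernel a (x / y)) * F x := by
    filter_upwards [measure_eq_zero_iff_ae_notMem.1 hμ] with y hy
    have hy : y ≠ 0 := hy
    have h1 : Measurable fun x => ENNReal.ofReal (gammaKernel a (x / y)) * F x := by fun_prop
    have h2 := lintegral_map (μ := volume) h1 (measurable_mul_const y)
    rw [Real.map_volume_mul_right hy, lintegral_smul_measure, smul_eq_mul,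
      ← lintegral_const_mul _ h1] at h2
    rw [gammaMeasure_one_eq_withDensity, lintegral_withDensity_eq_lintegral_mul _
      hk.ennreal_ofReal (by fun_prop)]
    -- Substitution `x = t * y`, with Jacobian `|y|⁻¹`.
    refine (lintegral_congr fun t => ?_).trans (h2.symm.trans (lintegral_congr fun x => ?_))
    · simp [mul_div_cancel_right₀ _ hy]
    · rw [ENNReal.ofReal_mul (by positivity), abs_inv, mul_assoc]
  rw [lintegral_congr_ae hscale, lintegral_lintegral_swap (by fun_prop)]
  have hne : ∀ᵐ x : ℝ, x ≠ 0 := by simp [ae_iff]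
  refine lintegral_congr_ae ?_
  filter_upwards [hne] with x hx
  rw [lintegral_mul_const _ (by fun_prop), Pi.mul_apply,
    lintegral_inv_mul_gammaKernel_eq_gammaMixtureDensity ha hx]

/-! ### The law of the mean of the gamma process -/

theorem proposition1 {Ω Ω' : Type*} [MeasurableSpace Ω] [MeasurableSpace Ω']
    (P : Measure Ω) [IsProbabilityMeasure P] (P' : Measure Ω') [IsProbabilityMeasure P']
    (a : ℝ) (ha : 0 < a) (α : FiniteMeasure ℝ) (hα : α ∈ logMeasures a)
    (hα0 : (α : Measure ℝ).real {0} < a)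
    (γ : Ω → FiniteMeasure ℝ) (hγ : IsGammaProcess P α γ)
    (φ : Ω' → ProbabilityMeasure ℝ) (hφ : IsDirichletProcess P' α φ)
    (μ : Measure ℝ) (hμ : μ = P'.map fun ω => ∫ x, x ∂(φ ω : Measure ℝ)) :
    -- the two random means are almost surely finite random variables
    (∀ᵐ ω ∂P, Integrable (fun x : ℝ => x) (γ ω : Measure ℝ)) ∧
    AEMeasurable (fun ω => ∫ x, x ∂(γ ω : Measure ℝ)) P ∧
    (∀ᵐ ω ∂P', Integrable (fun x : ℝ => x) (φ ω : Measure ℝ)) ∧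
    AEMeasurable (fun ω => ∫ x, x ∂(φ ω : Measure ℝ)) P' ∧
    -- the law of the mean of the gamma process is absolutely continuous
    (P.map fun ω => ∫ x, x ∂(γ ω : Measure ℝ)) ≪ volume ∧
    -- the mixture integrals converge off the origin, and the mixture is a density of that law
    (∀ x : ℝ, x < 0 →
      IntegrableOn (fun y : ℝ => |y| ^ (-a) * Real.exp (-x / y)) (Set.Iio 0) μ) ∧
    (∀ x : ℝ, 0 < x →
      IntegrableOn (fun y : ℝ => y ^ (-a) * Real.exp (-x / y)) (Set.Ioi 0) μ) ∧
    Measurable (gammaMixtureDensity a μ) ∧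
    (P.map fun ω => ∫ x, x ∂(γ ω : Measure ℝ)) =
      volume.withDensity fun x => ENNReal.ofReal (gammaMixtureDensity a μ x) := by
  obtain ⟨hmass, hlog⟩ := hα
  have hα' : (α : Measure ℝ) ≠ 0 := fun h => by
    rw [h] at hmass
    simp at hmass
    exact ha.ne hmass
  have hαc : (α : Measure ℝ) {0}ᶜ ≠ 0 := fun h => by
    have h1 := measureReal_add_measureReal_compl (μ := (α : Measure ℝ))
      (measurableSet_singleton (0 : ℝ))
    rw [hmass, measureReal_def _ {0}ᶜ, h, ENNReal.toReal_zero, add_zero] at h1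
    exact hα0.ne h1
  have hG := isProbabilityMeasure_gammaMeasure ha one_pos
  have hκ := hγ.hasGammaIntegrals
  have hκ' := hφ.hasGammaIntegrals
  rw [hmass] at hκ'
  have hpos : ∀ᵐ p ∂((gammaMeasure a 1).prod P'), 0 < p.1 :=
    Measure.quasiMeasurePreserving_fst.ae (ae_pos_gammaMeasure_one a)
  have hmγ : Measurable fun ω => ∫ x, x ∂(γ ω : Measure ℝ) :=
    measurable_integral_of_measurable hγ.measurable_coe measurable_id
  have hmφ : Measurable fun ω => ∫ x, x ∂(φ ω : Measure ℝ) :=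
    measurable_integral_of_measurable hφ.measurable_coe measurable_id
  have hintφ : ∀ᵐ ω ∂P', Integrable (fun x : ℝ => x) (φ ω : Measure ℝ) := by
    have h1 : ∀ᵐ p ∂((gammaMeasure a 1).prod P'),
        Integrable (fun x : ℝ => x) (φ p.2 : Measure ℝ) := by
      filter_upwards [hpos, hκ'.ae_integrable hα' hlog] with p hp hi
      exact (integrable_smul_measure (ENNReal.ofReal_pos.2 hp).ne' ENNReal.ofReal_ne_top).1 hi
    -- The property does not involve the gamma coordinate, so one good value of that coordinate
    -- suffices.
    exact (Measure.ae_ae_of_ae_prod h1).exists.choose_spec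
  have hμprob : IsProbabilityMeasure μ := hμ ▸ Measure.isProbabilityMeasure_map hmφ.aemeasurable
  have hlaw : (P.map fun ω => ∫ x, x ∂(γ ω : Measure ℝ)) =
      ((gammaMeasure a 1).prod μ).map fun p => p.1 * p.2 := by
    rw [hκ.map_integral_id_eq hκ' hα' hlog, hμ]
    nth_rewrite 2 [← Measure.map_id (μ := gammaMeasure a 1)]
    rw [Measure.map_prod_map _ _ measurable_id hmφ, Measure.map_map (by fun_prop)
      (measurable_id.prodMap hmφ)]
    refine Measure.map_congr ?_
    filter_upwards [hpos] with p hp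
    exact integral_ofReal_smul hp fun x => x
  have hμ0 : μ {0} = 0 := by
    have := Measure.isProbabilityMeasure_map hmγ.aemeasurable (μ := P)
    have h0 := measure_singleton_zero_of_tendsto_charFun _
      fun u hu => hκ.tendsto_charFun hlog hαc hu
    rw [hlaw, Measure.map_apply (by fun_prop) (measurableSet_singleton 0)] at h0
    -- An atom of `μ` at `0` would make the product vanish with the same probability, the gamma
    -- factor having total mass one.
    have h1 : Set.univ ×ˢ {0} ⊆ (fun p : ℝ × ℝ => p.1 * p.2) ⁻¹' {0} := by
      rintro ⟨t, y⟩ ⟨-, hy⟩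
      have hy : y = 0 := hy
      simp [hy]
    simpa [Measure.prod_prod] using measure_mono_null h1 h0
  have hdens := hlaw.trans (map_mul_gammaMeasure_prod ha μ hμ0)
  refine ⟨hκ.ae_integrable hα' hlog, hmγ.aemeasurable, hintφ, hmφ.aemeasurable, ?_, ?_, ?_,
    measurable_gammaMixtureDensity a μ, hdens⟩
  · rw [hdens]
    exact withDensity_absolutelyContinuous _ _
  · exact fun x hx => integrableOn_rpow_mul_exp ha μ measurableSet_Iio
      fun y hy => div_pos_of_neg_of_neg hx hy
  · intro x hx
    refine (integrableOn_rpow_mul_exp ha μ measurableSet_Ioi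
      fun y hy => div_pos hx hy).congr_fun (fun y hy => ?_) measurableSet_Ioi
    simp only [abs_of_pos (Set.mem_Ioi.1 hy)]
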